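/- Let $E$ be a finite-dimensional complex Hilbert space and let $\mathcal L(E)$ be the algebra of linear operators on $E$. For $F=E$ or $F=\mathcal L(E)$, let $L^2(F)$ be the space of square-integrable $F$-valued functions on the unit circle $\mathbb T$ with respect to normalized arc length, and let $H^2(F)\subset L^2(F)$ be the subspace of functions whose Fourier coefficients of negative index vanish (identified with analytic functions in the unit disc). Let $\Theta\in H^2(\mathcal L(E))$ be a pure inner function, that is, $\Theta(e^{it})$ is unitary for almost every $t$ and $\|\Theta(0)\|<1$. Let $\mathcal K_\Theta=H^2(E)\ominus\Theta H^2(E)$, let $P_\Theta$ be the orthogonal projection of $L^2(E)$ onto $\mathcal K_\Theta$, and let $\mathcal K_\Theta^\infty$ be the dense subspace of $\mathcal K_\Theta$ formed by its bounded functions. For $\Psi\in L^2(\mathcal L(E))$, if the linear map $f\mapsto P_\Theta(\Psi f)$ from $\mathcal K_\Theta^\infty$ to $\mathcal K_\Theta$ is bounded, the matrix-valued truncated Toeplitz operator $A_\Psi$ is its bounded extension to $\mathcal K_\Theta$. Theorem. Let $\Psi\in L^2(\mathcal L(E))$. Then $A_\Psi=0$ (that is, the map above is bounded and its bounded extension is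 the zero operator) if and only if there exist $\Phi_1,\Phi_2\in H^2(\mathcal L(E))$ such that $$\Psi=\Theta\Phi_1+\Phi_2^*\Theta^*\quad\text{almost everywhere on }\mathbb T,$$ equivalently, $\Psi\in\Theta H^2(\mathcal L(E))+(\Theta H^2(\mathcal L(E)))^*$. -/

import Mathlib

open MeasureTheory
open scoped ENNReal

noncomputable section

/-- The circle `ℝ / 2πℤ` has positive length. -/
instance instFactTwoPiPos : Fact (0 < 2 * Real.pi) := ⟨Real.two_pi_pos⟩

/-- Points of the unit circle, written as `exp (i t)` with `t` modulo `2π`. -/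
abbrev TCircle : Type := AddCircle (2 * Real.pi)

/-- Normalized arc length `dt / 2π` on the unit circle. -/
abbrev arcLength : Measure TCircle := AddCircle.haarAddCircle

/-- The space `L²(F)` of square integrable `F`-valued functions on the circle. For `F = L(E)` with
`E` finite dimensional the operator norm is equivalent to the Hilbert--Schmidt norm, so that this is
the usual space of matrix functions with entries in `L²`. -/
abbrev L2 (F : Type*) [NormedAddCommGroup F] : Type _ := Lp F 2 arcLength

section Hardy

variable {F : Type*} [NormedAddCommGroup F] [NormedSpace ℂ F]

lemma L2.integrable (f : L2 F) : Integrable f arcLength :=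
  (Lp.memLp f).integrable (by norm_num)

/-- The Hardy space `H²(F)`: functions in `L²(F)` whose negative Fourier coefficients vanish. -/
def hardySpace (F : Type*) [NormedAddCommGroup F] [NormedSpace ℂ F] : Submodule ℂ (L2 F) where
  carrier := {f | ∀ n : ℤ, n < 0 → fourierCoeff f n = 0}
  zero_mem' := by
    intro n _
    rw [fourierCoeff_congr_ae (Lp.coeFn_zero F 2 arcLength)]
    simp [fourierCoeff]
  add_mem' := by
    intro f g hf hg n hn
    rw [fourierCoeff_congr_ae (Lp.coeFn_add f g),
      fourierCoeff.add (L2.integrable f) (L2.integrable g)]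
    simp [hf n hn, hg n hn]
  smul_mem' := by
    intro c f hf n hn
    rw [fourierCoeff_congr_ae (Lp.coeFn_smul c f)]
    have := fourierCoeff.const_smul (f : TCircle → F) c n
    rw [this, hf n hn, smul_zero]

lemma norm_fourierCoeff_le (f : L2 F) (n : ℤ) : ‖fourierCoeff f n‖ ≤ ‖f‖ := by
  have h1 : ‖fourierCoeff f n‖ ≤ ∫ t, ‖f t‖ ∂arcLength := by
    refine (norm_integral_le_integral_norm _).trans (le_of_eq ?_)
    refine integral_congr_ae (Filter.Eventually.of_forall fun t => ?_)
    change ‖fourier (-n) t • f t‖ = ‖f t‖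
    rw [norm_smul, fourier_apply, Circle.norm_coe, one_mul]
  refine h1.trans ?_
  rw [integral_norm_eq_lintegral_enorm (Lp.aestronglyMeasurable f),
    ← eLpNorm_one_eq_lintegral_enorm, Lp.norm_def]
  exact ENNReal.toReal_mono (Lp.eLpNorm_ne_top f)
    (eLpNorm_le_eLpNorm_of_exponent_le (by norm_num) (Lp.aestronglyMeasurable f))

lemma isClosed_hardySpace : IsClosed (hardySpace F : Set (L2 F)) := by
  have hc : ∀ n : ℤ, Continuous fun f : L2 F => fourierCoeff f n := by
    intro n
    refine LipschitzWith.continuous (K := 1) (LipschitzWith.of_dist_le_mul fun f g => ?_)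
    have h : fourierCoeff f n = fourierCoeff (f - g : L2 F) n + fourierCoeff g n := by
      have h1 := congrFun (fourierCoeff_congr_ae (Lp.coeFn_add (f - g) g)) n
      rw [fourierCoeff.add (L2.integrable _) (L2.integrable g), sub_add_cancel] at h1
      simpa using h1
    rw [dist_eq_norm, dist_eq_norm, h, add_sub_cancel_right, NNReal.coe_one, one_mul]
    exact norm_fourierCoeff_le _ _
  have : (hardySpace F : Set (L2 F)) =
      ⋂ n : ℤ, ⋂ _ : n < 0, {f : L2 F | fourierCoeff f n = 0} := by
    ext f
    simp [hardySpace]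
  rw [this]
  exact isClosed_iInter fun n => isClosed_iInter fun _ => isClosed_eq (hc n) continuous_const

end Hardy

section ModelSpace

variable {E : Type*} [NormedAddCommGroup E] [InnerProductSpace ℂ E] [CompleteSpace E]

/-- Inner functions: elements of `H²(L(E))` with unitary boundary values almost everywhere. -/
def IsInner (Θ : L2 (E →L[ℂ] E)) : Prop :=
  Θ ∈ hardySpace (E →L[ℂ] E) ∧ ∀ᵐ t ∂arcLength, Θ t ∈ unitary (E →L[ℂ] E)

/-- Pure inner functions: `‖Θ(0)‖ < 1`, where the value at the origin of the analytic extension of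
`Θ` to the disc is its zeroth Fourier coefficient. -/
def IsPureInner (Θ : L2 (E →L[ℂ] E)) : Prop :=
  IsInner Θ ∧ ‖fourierCoeff Θ 0‖ < 1

/-- The space `Θ H²(E)`. -/
def thetaHardy (Θ : L2 (E →L[ℂ] E)) : Submodule ℂ (L2 E) where
  carrier := {f | ∃ g ∈ hardySpace E, f =ᵐ[arcLength] fun t => Θ t (g t)}
  zero_mem' := by
    refine ⟨0, zero_mem _, ?_⟩
    filter_upwards [Lp.coeFn_zero E 2 arcLength] with t ht
    rw [ht, Pi.zero_apply, map_zero]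
  add_mem' := by
    rintro f₁ f₂ ⟨g₁, hg₁, h₁⟩ ⟨g₂, hg₂, h₂⟩
    refine ⟨g₁ + g₂, add_mem hg₁ hg₂, ?_⟩
    filter_upwards [h₁, h₂, Lp.coeFn_add f₁ f₂, Lp.coeFn_add g₁ g₂] with t a b c d
    rw [c, d, Pi.add_apply, Pi.add_apply, a, b, map_add]
  smul_mem' := by
    rintro c f ⟨g, hg, h⟩
    refine ⟨c • g, Submodule.smul_mem _ c hg, ?_⟩
    filter_upwards [h, Lp.coeFn_smul c f, Lp.coeFn_smul c g] with t a b d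
    rw [b, d, Pi.smul_apply, Pi.smul_apply, a, map_smul]

/-- The model space `K_Θ = H²(E) ⊖ Θ H²(E)`. -/
def modelSpace (Θ : L2 (E →L[ℂ] E)) : Submodule ℂ (L2 E) :=
  hardySpace E ⊓ (thetaHardy Θ)ᗮ

lemma isClosed_modelSpace (Θ : L2 (E →L[ℂ] E)) : IsClosed (modelSpace Θ : Set (L2 E)) :=
  isClosed_hardySpace.inter (Submodule.isClosed_orthogonal _)

instance modelSpace.completeSpace (Θ : L2 (E →L[ℂ] E)) : CompleteSpace (modelSpace Θ) :=
  (isClosed_modelSpace Θ).completeSpace_coe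

/-- The subspace `K_Θ^∞` of the (essentially) bounded functions in `K_Θ`. -/
def boundedModelSpace (Θ : L2 (E →L[ℂ] E)) : Submodule ℂ (modelSpace Θ) where
  carrier := {f | MemLp (f : L2 E) ∞ arcLength}
  zero_mem' := (memLp_congr_ae (Lp.coeFn_zero E 2 arcLength)).2 MemLp.zero
  add_mem' := fun {f g} hf hg =>
    (memLp_congr_ae (Lp.coeFn_add (f : L2 E) (g : L2 E))).2 (hf.add hg)
  smul_mem' := fun c f hf =>
    (memLp_congr_ae (Lp.coeFn_smul c (f : L2 E))).2 (hf.const_smul c)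

lemma memLp_symbol_apply (Φ : L2 (E →L[ℂ] E)) {f : TCircle → E} (hf : MemLp f ∞ arcLength) :
    MemLp (fun t => Φ t (f t)) 2 arcLength :=
  (ContinuousLinearMap.id ℂ (E →L[ℂ] E)).memLp_of_bilin 2 (Lp.memLp Φ) hf

/-- The linear map `f ↦ P_Θ (Φ f)` from `K_Θ^∞` to `K_Θ`, where `P_Θ` is the orthogonal projection
of `L²(E)` onto `K_Θ`. -/
def compression (Θ Φ : L2 (E →L[ℂ] E)) : boundedModelSpace Θ →ₗ[ℂ] modelSpace Θ where
  toFun f := (modelSpace Θ).orthogonalProjectionOnto ((memLp_symbol_apply Φ f.2).toLp _)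
  map_add' f g := by
    rw [← map_add, ← MemLp.toLp_add]
    congr 1
    refine MemLp.toLp_congr _ _ ?_
    filter_upwards [Lp.coeFn_add (f : L2 E) (g : L2 E)] with t ht
    change Φ t (((f : L2 E) + (g : L2 E) : L2 E) t) = Φ t ((f : L2 E) t) + Φ t ((g : L2 E) t)
    rw [ht, Pi.add_apply, map_add]
  map_smul' c f := by
    rw [RingHom.id_apply, ← map_smul, ← MemLp.toLp_const_smul]
    congr 1
    refine MemLp.toLp_congr _ _ ?_
    filter_upwards [Lp.coeFn_smul c (f : L2 E)] with t ht
    change Φ t ((c • (f : L2 E) : L2 E) t) = c • Φ t ((f : L2 E) t)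
    rw [ht, Pi.smul_apply, map_smul]

/-- `A` is the matrix valued truncated Toeplitz operator `A_Φ` on `K_Θ` with symbol `Φ`: a bounded
operator on `K_Θ` that extends `f ↦ P_Θ (Φ f)` from `K_Θ^∞`. -/
def IsTruncatedToeplitz (Θ Φ : L2 (E →L[ℂ] E)) (A : modelSpace Θ →L[ℂ] modelSpace Θ) : Prop :=
  ∀ f : boundedModelSpace Θ, A f = compression Θ Φ f

end ModelSpace

end

open MeasureTheory
open scoped ENNReal

/-! Write f(0) for the zeroth Fourier coefficient and K for the model space. Then A_Ψ = 0 means that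
the form ∫⟨g, Ψf⟩ vanishes for all bounded f, g in K (`isTruncatedToeplitz_zero_iff_annihilates`,
which rests on the density of the bounded functions). Symbols ΘΦ with Φ analytic have vanishing form
because ΘΦf is orthogonal to K; adjoints and sums inherit this, which gives sufficiency.

For necessity, the backward shift f ↦ z̄(f - f(0)) preserves the bounded functions of K. Subtracting
the form at the shifted pair from the form at (f, g) cancels z̄ and leaves ∫⟨g, Ψf(0)⟩ + ⟨g(0), c⟩ =
0, with c independent of g (`Annihilates.displacement`). So Ψf(0) + c is orthogonal to K, that is,
it lies in ΘH² plus strictly antianalytic functions. Purity makes every vector x a value f(0), so at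
positive indices Ψx has the coefficients of some Θk. Assembling columns gives Φ₁
(`Annihilates.exists_analytic_factor`), and the same argument for Ψ* gives Φ₂.

The remainder Ψ - ΘΦ₁ - (ΘΦ₂)* is then a constant B whose form vanishes, and one more use of
displacement forces B = 0. -/

lemma MeasureTheory.MemLp.integrable_circle {F : Type*} [NormedAddCommGroup F] {f : TCircle → F}
    (hf : MemLp f 2 arcLength) : Integrable f arcLength :=
  hf.integrable (by norm_num)

/-! ### Calculus of Fourier coefficients -/

section FourierCoefficients

variable {F G : Type*} [NormedAddCommGroup F] [NormedSpace ℂ F] [NormedAddCommGroup G]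
  [NormedSpace ℂ G]

lemma norm_fourier_apply (n : ℤ) (t : TCircle) : ‖fourier n t‖ = 1 := by
  rw [fourier_apply, Circle.norm_coe]

lemma memLp_fourier_smul {p : ℝ≥0∞} {f : TCircle → F} (hf : MemLp f p arcLength) (n : ℤ) :
    MemLp (fun t => fourier n t • f t) p arcLength := by
  refine MemLp.of_le hf
    ((fourier n).continuous.aestronglyMeasurable.smul hf.aestronglyMeasurable) ?_
  filter_upwards with t
  rw [norm_smul, norm_fourier_apply, one_mul]

lemma fourierCoeff_fun_add {f g : TCircle → F} (hf : Integrable f arcLength)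
    (hg : Integrable g arcLength) (n : ℤ) :
    fourierCoeff (fun t => f t + g t) n = fourierCoeff f n + fourierCoeff g n :=
  congrFun (fourierCoeff.add hf hg) n

lemma fourierCoeff_fun_sub {f g : TCircle → F} (hf : Integrable f arcLength)
    (hg : Integrable g arcLength) (n : ℤ) :
    fourierCoeff (fun t => f t - g t) n = fourierCoeff f n - fourierCoeff g n := by
  have h := fourierCoeff_fun_add (hf.sub hg) hg n
  simp only [Pi.sub_apply, sub_add_cancel] at h
  exact eq_sub_of_add_eq h.symm

lemma fourierCoeff_clm_apply [CompleteSpace F] [CompleteSpace G] (L : F →L[ℂ] G)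
    {f : TCircle → F} (hf : Integrable f arcLength) (n : ℤ) :
    fourierCoeff (fun t => L (f t)) n = L (fourierCoeff f n) := by
  rw [fourierCoeff, fourierCoeff, ← L.integral_comp_comm (hf.fourier_smul _)]
  simp only [map_smul]

lemma fourierCoeff_fourier_smul (f : TCircle → F) (m n : ℤ) :
    fourierCoeff (fun t => fourier m t • f t) n = fourierCoeff f (n - m) := by
  unfold fourierCoeff
  congr 1
  funext t
  rw [smul_smul, ← fourier_add]
  congr 2
  ring_nf

lemma fourierCoeff_fun_const [CompleteSpace F] (c : F) (n : ℤ) :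
    fourierCoeff (fun _ : TCircle => c) n = if n = 0 then c else 0 := by
  have h := fourierCoeff_clm_apply ((ContinuousLinearMap.id ℂ ℂ).smulRight c)
    (f := fourier (T := 2 * Real.pi) 0)
    ((fourier 0).continuous.integrable_of_hasCompactSupport (HasCompactSupport.of_compactSpace _)) n
  rw [fourierCoeff_fourier] at h
  simp only [ContinuousLinearMap.smulRight_apply, fourier_zero, ContinuousLinearMap.id_apply,
    one_smul] at h
  rw [h]
  by_cases hn : n = 0
  · simp [hn]
  · simp [hn]

end FourierCoefficients

/-! ### Vector-valued Hardy space and products of analytic functions -/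

section Vector

variable {E : Type*} [NormedAddCommGroup E] [InnerProductSpace ℂ E] [CompleteSpace E]

lemma fourierCoeff_const_inner (x : E) {f : TCircle → E} (hf : Integrable f arcLength) (n : ℤ) :
    fourierCoeff (fun t => inner ℂ x (f t)) n = inner ℂ x (fourierCoeff f n) :=
  fourierCoeff_clm_apply (innerSL ℂ x) hf n

lemma integral_inner_fourier_smul (x : E) {f : TCircle → E} (hf : Integrable f arcLength) (n : ℤ) :
    ∫ t, inner ℂ (fourier n t • x) (f t) ∂arcLength = inner ℂ x (fourierCoeff f n) := by
  rw [← fourierCoeff_const_inner x hf, fourierCoeff]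
  congr 1
  funext t
  rw [inner_smul_left, fourier_neg, smul_eq_mul]

lemma memLp_star {p : ℝ≥0∞} {Φ : TCircle → E →L[ℂ] E} (hΦ : MemLp Φ p arcLength) :
    MemLp (fun t => star (Φ t)) p arcLength :=
  hΦ.star

lemma fourierCoeff_star {Φ : TCircle → E →L[ℂ] E} (hΦ : Integrable Φ arcLength) (n : ℤ) :
    fourierCoeff (fun t => star (Φ t)) n = star (fourierCoeff Φ (-n)) := by
  have h := (starL' ℝ (A := E →L[ℂ] E)).toContinuousLinearMap.integral_comp_comm
    (hΦ.fourier_smul (n := - -n))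
  unfold fourierCoeff
  refine Eq.trans ?_ h
  congr 1
  funext t
  change _ = star (fourier (- -n) t • Φ t)
  rw [star_smul, neg_neg, fourier_neg]
  rfl

lemma fourierCoeff_apply_const {Φ : TCircle → E →L[ℂ] E} (hΦ : Integrable Φ arcLength) (x : E)
    (n : ℤ) : fourierCoeff (fun t => Φ t x) n = fourierCoeff Φ n x :=
  fourierCoeff_clm_apply (ContinuousLinearMap.apply ℂ E x) hΦ n

lemma fourierCoeff_star_apply_const {Φ : TCircle → E →L[ℂ] E} (hΦ : MemLp Φ 2 arcLength) (x : E)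
    (n : ℤ) : fourierCoeff (fun t => star (Φ t) x) n = star (fourierCoeff Φ (-n)) x := by
  rw [← fourierCoeff_star hΦ.integrable_circle]
  exact fourierCoeff_apply_const (memLp_star hΦ).integrable_circle x n

lemma integrable_inner_L2 {u v : TCircle → E} (hu : MemLp u 2 arcLength)
    (hv : MemLp v 2 arcLength) : Integrable (fun t => inner ℂ (u t) (v t)) arcLength := by
  have h := L2.integrable_inner (𝕜 := ℂ) (hu.toLp u) (hv.toLp v)
  refine h.congr ?_
  filter_upwards [hu.coeFn_toLp, hv.coeFn_toLp] with t a b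
  rw [a, b]

lemma inner_toLp_L2 {u v : TCircle → E} (hu : MemLp u 2 arcLength) (hv : MemLp v 2 arcLength) :
    inner ℂ (hu.toLp u) (hv.toLp v) = ∫ t, inner ℂ (u t) (v t) ∂arcLength := by
  rw [L2.inner_def]
  refine integral_congr_ae ?_
  filter_upwards [hu.coeFn_toLp, hv.coeFn_toLp] with t a b
  rw [a, b]

/-- A square integrable function is determined by its Fourier coefficients. -/
lemma ae_eq_zero_of_fourierCoeff_eq_zero [FiniteDimensional ℂ E] {f : TCircle → E}
    (hf : MemLp f 2 arcLength) (h : ∀ n, fourierCoeff f n = 0) : f =ᵐ[arcLength] 0 := by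
  let b := stdOrthonormalBasis ℂ E
  have hb : ∀ i, ∀ᵐ t ∂arcLength, inner ℂ (b i) (f t) = 0 := by
    intro i
    have hm : MemLp (fun t => inner ℂ (b i) (f t)) 2 arcLength := hf.const_inner _
    have hz : hm.toLp _ = 0 := by
      apply fourierBasis.repr.injective
      ext n
      rw [fourierBasis_repr, map_zero, fourierCoeff_congr_ae hm.coeFn_toLp,
        fourierCoeff_const_inner _ hf.integrable_circle, h n, inner_zero_right]
      rfl
    have := hm.coeFn_toLp
    rw [hz] at this
    filter_upwards [this, Lp.coeFn_zero ℂ 2 arcLength] with t h1 h2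
    rw [← h1, h2, Pi.zero_apply]
  filter_upwards [ae_all_iff.2 hb] with t ht
  rw [← b.sum_repr' (f t)]
  simp [ht]

instance hardySpace.completeSpace : CompleteSpace (hardySpace E) :=
  isClosed_hardySpace.completeSpace_coe

lemma memLp_const_circle {F : Type*} [NormedAddCommGroup F] (p : ℝ≥0∞) (c : F) :
    MemLp (fun _ : TCircle => c) p arcLength :=
  memLp_const c

/-- For n ≥ 0 the monomial z^n x lies in H², and pairing with it reads off ⟨x, f̂(n)⟩. -/
lemma fourierCoeff_eq_zero_of_mem_orthogonal {f : L2 E} (hf : f ∈ (hardySpace E)ᗮ) {n : ℤ}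
    (hn : 0 ≤ n) : fourierCoeff f n = 0 := by
  have hx : ∀ x : E, inner ℂ x (fourierCoeff f n) = 0 := by
    intro x
    have hm := memLp_fourier_smul (memLp_const_circle 2 x) n
    have hmem : hm.toLp _ ∈ hardySpace E := by
      intro k hk
      rw [fourierCoeff_congr_ae hm.coeFn_toLp, fourierCoeff_fourier_smul, fourierCoeff_fun_const,
        if_neg (by omega)]
    have h := hf _ hmem
    rw [← integral_inner_fourier_smul x (L2.integrable f), ← h, L2.inner_def]
    refine integral_congr_ae ?_
    filter_upwards [hm.coeFn_toLp] with t ht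
    rw [ht]
  exact inner_self_eq_zero.1 (hx _)

/-- The analytic part of a square integrable function. -/
lemma exists_analytic_part {u : TCircle → E} (hu : MemLp u 2 arcLength) :
    ∃ h ∈ hardySpace E, (∀ n, 0 ≤ n → fourierCoeff h n = fourierCoeff u n) ∧
      hu.toLp u - h ∈ (hardySpace E)ᗮ := by
  refine ⟨(hardySpace E).starProjection (hu.toLp u), Submodule.starProjection_apply_mem _ _, ?_,
    Submodule.sub_starProjection_mem_orthogonal _⟩
  intro n hn
  have h := fourierCoeff_eq_zero_of_mem_orthogonal
    (Submodule.sub_starProjection_mem_orthogonal (K := hardySpace E) (hu.toLp u)) hn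
  rw [fourierCoeff_congr_ae (Lp.coeFn_sub _ _)] at h
  have h2 := fourierCoeff_fun_sub (L2.integrable (hu.toLp u))
    (L2.integrable ((hardySpace E).starProjection (hu.toLp u))) n
  rw [fourierCoeff_congr_ae hu.coeFn_toLp] at h2
  exact (sub_eq_zero.1 (h2.symm.trans h)).symm

lemma toLp_mem_orthogonal_hardySpace [FiniteDimensional ℂ E] {v : TCircle → E}
    (hv : MemLp v 2 arcLength) (h : ∀ n, 0 ≤ n → fourierCoeff v n = 0) :
    hv.toLp v ∈ (hardySpace E)ᗮ := by
  obtain ⟨p, hp, hpc, hpo⟩ := exists_analytic_part hv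
  have hz : (p : TCircle → E) =ᵐ[arcLength] 0 := by
    refine ae_eq_zero_of_fourierCoeff_eq_zero (Lp.memLp p) fun n => ?_
    rcases lt_or_ge n 0 with hn | hn
    · exact hp n hn
    · rw [hpc n hn, h n hn]
  rw [Lp.eq_zero_iff_ae_eq_zero.2 hz, sub_zero] at hpo
  exact hpo

lemma toLp_mem_hardySpace {F : Type*} [NormedAddCommGroup F] [NormedSpace ℂ F] {u : TCircle → F}
    (hu : MemLp u 2 arcLength) (h : ∀ n < 0, fourierCoeff u n = 0) :
    hu.toLp u ∈ hardySpace F := by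
  intro n hn
  rw [fourierCoeff_congr_ae hu.coeFn_toLp, h n hn]

/-- Analytic functions are orthogonal to strictly antianalytic functions. -/
lemma integral_inner_eq_zero_of_fourierCoeff [FiniteDimensional ℂ E] {u v : TCircle → E}
    (hu : MemLp u 2 arcLength) (hv : MemLp v 2 arcLength)
    (hu' : ∀ n < 0, fourierCoeff u n = 0) (hv' : ∀ n, 0 ≤ n → fourierCoeff v n = 0) :
    ∫ t, inner ℂ (u t) (v t) ∂arcLength = 0 := by
  rw [← inner_toLp_L2 hu hv]
  exact toLp_mem_orthogonal_hardySpace hv hv' _ (toLp_mem_hardySpace hu hu')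

lemma memLp_apply {p : ℝ≥0∞} {Φ : TCircle → E →L[ℂ] E} {f : TCircle → E} (hΦ : MemLp Φ p arcLength)
    (hf : MemLp f ∞ arcLength) : MemLp (fun t => Φ t (f t)) p arcLength :=
  (ContinuousLinearMap.id ℂ (E →L[ℂ] E)).memLp_of_bilin p hΦ hf

lemma memLp_bounded_apply {p : ℝ≥0∞} {Φ : TCircle → E →L[ℂ] E} {f : TCircle → E}
    (hΦ : MemLp Φ ∞ arcLength) (hf : MemLp f p arcLength) :
    MemLp (fun t => Φ t (f t)) p arcLength :=
  (ContinuousLinearMap.id ℂ (E →L[ℂ] E)).memLp_of_bilin p hΦ hf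

lemma integrable_apply {Φ : TCircle → E →L[ℂ] E} {f : TCircle → E} (hΦ : MemLp Φ 2 arcLength)
    (hf : MemLp f 2 arcLength) : Integrable (fun t => Φ t (f t)) arcLength :=
  memLp_one_iff_integrable.1 ((ContinuousLinearMap.id ℂ (E →L[ℂ] E)).memLp_of_bilin 1 hΦ hf)

/-- The product of analytic functions is analytic. -/
lemma fourierCoeff_apply_eq_zero [FiniteDimensional ℂ E] {Φ : TCircle → E →L[ℂ] E}
    {f : TCircle → E} (hΦ : MemLp Φ 2 arcLength) (hf : MemLp f 2 arcLength)
    (hΦ' : ∀ n < 0, fourierCoeff Φ n = 0) (hf' : ∀ n < 0, fourierCoeff f n = 0) {n : ℤ}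
    (hn : n < 0) : fourierCoeff (fun t => Φ t (f t)) n = 0 := by
  have hx : ∀ x : E, inner ℂ x (fourierCoeff (fun t => Φ t (f t)) n) = 0 := by
    intro x
    rw [← integral_inner_fourier_smul x (integrable_apply hΦ hf)]
    -- Φf is only known to be integrable, so Φ is moved onto the constant x: Φ*x is square
    -- integrable, and z^n Φ*x is strictly antianalytic because n < 0.
    have hs : MemLp (fun t => star (Φ t) x) 2 arcLength :=
      memLp_apply (memLp_star hΦ) (memLp_const_circle ∞ x)
    have h := integral_inner_eq_zero_of_fourierCoeff hf (memLp_fourier_smul hs n) hf' (by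
      intro k hk
      rw [fourierCoeff_fourier_smul, fourierCoeff_star_apply_const hΦ, hΦ' _ (by omega), star_zero,
        zero_apply])
    rw [← map_zero (starRingEnd ℂ), ← h, ← integral_conj]
    congr 1
    funext t
    rw [inner_conj_symm, inner_smul_left, inner_smul_left, ContinuousLinearMap.star_eq_adjoint,
      ContinuousLinearMap.adjoint_inner_left]
  exact inner_self_eq_zero.1 (hx _)

end Vector

/-! ### The model space and the density of its bounded functions -/

section Model

variable {E : Type*} [NormedAddCommGroup E] [InnerProductSpace ℂ E] [CompleteSpace E]

lemma IsInner.memLp_top {Θ : L2 (E →L[ℂ] E)} (hΘ : IsInner Θ) : MemLp Θ ∞ arcLength := by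
  refine memLp_top_of_bound (Lp.aestronglyMeasurable Θ) 1 ?_
  filter_upwards [hΘ.2] with t ht
  refine ContinuousLinearMap.opNorm_le_bound _ zero_le_one fun x => ?_
  rw [one_mul, ContinuousLinearMap.norm_map_of_mem_unitary ht]

lemma IsInner.star_apply_apply {Θ : L2 (E →L[ℂ] E)} (hΘ : IsInner Θ) :
    ∀ᵐ t ∂arcLength, ∀ x, star (Θ t) (Θ t x) = x := by
  filter_upwards [hΘ.2] with t ht x
  exact congrArg (fun L : E →L[ℂ] E => L x) (Unitary.star_mul_self_of_mem ht)

lemma IsInner.fourierCoeff_apply_eq_zero [FiniteDimensional ℂ E] {Θ : L2 (E →L[ℂ] E)}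
    (hΘ : IsInner Θ) {f : TCircle → E} (hf : MemLp f 2 arcLength)
    (hf' : ∀ n < 0, fourierCoeff f n = 0) {n : ℤ} (hn : n < 0) :
    fourierCoeff (fun t => Θ t (f t)) n = 0 :=
  _root_.fourierCoeff_apply_eq_zero (Lp.memLp Θ) hf hΘ.1 hf' hn

lemma toLp_mem_thetaHardy {Θ : L2 (E →L[ℂ] E)} {g : TCircle → E} (hg : MemLp g 2 arcLength)
    (hg' : ∀ n < 0, fourierCoeff g n = 0) (hm : MemLp (fun t => Θ t (g t)) 2 arcLength) :
    hm.toLp _ ∈ thetaHardy Θ := by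
  refine ⟨hg.toLp g, toLp_mem_hardySpace hg hg', ?_⟩
  filter_upwards [hm.coeFn_toLp, hg.coeFn_toLp] with t a b
  rw [a, b]

/-- The model space in terms of Fourier coefficients: `f` is analytic and `Θ* f` is strictly
antianalytic. -/
lemma mem_modelSpace_iff [FiniteDimensional ℂ E] {Θ : L2 (E →L[ℂ] E)} (hΘ : IsInner Θ)
    {f : L2 E} : f ∈ modelSpace Θ ↔ (∀ n < 0, fourierCoeff f n = 0) ∧
      ∀ n, 0 ≤ n → fourierCoeff (fun t => star (Θ t) (f t)) n = 0 := by
  have hsm : MemLp (fun t => star (Θ t) (f t)) 2 arcLength :=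
    memLp_bounded_apply (memLp_star hΘ.memLp_top) (Lp.memLp f)
  refine and_congr Iff.rfl ⟨fun h n hn => ?_, fun h => ?_⟩
  · have hx : ∀ x : E, inner ℂ x (fourierCoeff (fun t => star (Θ t) (f t)) n) = 0 := by
      intro x
      have hz := memLp_fourier_smul (memLp_const_circle 2 x) n
      have hm := memLp_bounded_apply hΘ.memLp_top hz
      have hmem := toLp_mem_thetaHardy hz (fun k hk => by
        rw [fourierCoeff_fourier_smul, fourierCoeff_fun_const, if_neg (by omega)]) hm
      have h0 := h _ hmem
      rw [← integral_inner_fourier_smul x hsm.integrable_circle, ← h0, L2.inner_def]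
      refine integral_congr_ae ?_
      filter_upwards [hm.coeFn_toLp] with t ht
      rw [ht, ContinuousLinearMap.star_eq_adjoint, ContinuousLinearMap.adjoint_inner_right]
    exact inner_self_eq_zero.1 (hx _)
  · rintro g ⟨k, hk, hgk⟩
    rw [L2.inner_def, ← integral_inner_eq_zero_of_fourierCoeff (Lp.memLp k) hsm hk h]
    refine integral_congr_ae ?_
    filter_upwards [hgk] with t ht
    rw [ht, ContinuousLinearMap.star_eq_adjoint, ContinuousLinearMap.adjoint_inner_right]

/-- Bounded functions representing elements of the model space. -/
structure IsBoundedModel (Θ : L2 (E →L[ℂ] E)) (f : TCircle → E) : Prop where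
  memLp : MemLp f ∞ arcLength
  analytic : ∀ n < 0, fourierCoeff f n = 0
  antianalytic : ∀ n, 0 ≤ n → fourierCoeff (fun t => star (Θ t) (f t)) n = 0

lemma MeasureTheory.MemLp.two_of_top {F : Type*} [NormedAddCommGroup F] {f : TCircle → F}
    (hf : MemLp f ∞ arcLength) : MemLp f 2 arcLength :=
  hf.mono_exponent le_top

variable {Θ : L2 (E →L[ℂ] E)}

lemma IsBoundedModel.memLp_two {f : TCircle → E} (hf : IsBoundedModel Θ f) :
    MemLp f 2 arcLength :=
  hf.memLp.two_of_top

variable [FiniteDimensional ℂ E]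

lemma toLp_mem_modelSpace_iff (hΘ : IsInner Θ) {f : TCircle → E} (hf : MemLp f 2 arcLength) :
    hf.toLp f ∈ modelSpace Θ ↔ (∀ n < 0, fourierCoeff f n = 0) ∧
      ∀ n, 0 ≤ n → fourierCoeff (fun t => star (Θ t) (f t)) n = 0 := by
  have h : (fun t => star (Θ t) (hf.toLp f t)) =ᵐ[arcLength] fun t => star (Θ t) (f t) := by
    filter_upwards [hf.coeFn_toLp] with t ht
    rw [ht]
  rw [mem_modelSpace_iff hΘ, fourierCoeff_congr_ae hf.coeFn_toLp, fourierCoeff_congr_ae h]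

/-- Subtracting the `ΘH²` part of an analytic function leaves an element of the model space. -/
lemma sub_apply_mem_model (hΘ : IsInner Θ) {u : TCircle → E} (hu : MemLp u 2 arcLength)
    (hu' : ∀ n < 0, fourierCoeff u n = 0) {h : TCircle → E} (hh : MemLp h 2 arcLength)
    (hh' : ∀ n < 0, fourierCoeff h n = 0)
    (huh : ∀ n, 0 ≤ n → fourierCoeff h n = fourierCoeff (fun t => star (Θ t) (u t)) n) :
    (∀ n < 0, fourierCoeff (fun t => u t - Θ t (h t)) n = 0) ∧
      ∀ n, 0 ≤ n → fourierCoeff (fun t => star (Θ t) (u t - Θ t (h t))) n = 0 := by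
  constructor
  · intro n hn
    rw [fourierCoeff_fun_sub hu.integrable_circle
      (memLp_bounded_apply hΘ.memLp_top hh).integrable_circle, hu' n hn,
      hΘ.fourierCoeff_apply_eq_zero hh hh' hn, sub_zero]
  · intro n hn
    have hs : (fun t => star (Θ t) (u t - Θ t (h t))) =ᵐ[arcLength]
        fun t => star (Θ t) (u t) - h t := by
      filter_upwards [hΘ.star_apply_apply] with t ht
      rw [map_sub, ht]
    rw [fourierCoeff_congr_ae hs, fourierCoeff_fun_sub
      (memLp_bounded_apply (memLp_star hΘ.memLp_top) hu).integrable_circle hh.integrable_circle,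
      huh n hn, sub_self]

/-- A square integrable function with finitely supported Fourier coefficients is bounded. -/
lemma memLp_top_of_fourierCoeff_support {f : TCircle → E} (hf : MemLp f 2 arcLength)
    (s : Finset ℤ) (h : ∀ n ∉ s, fourierCoeff f n = 0) : MemLp f ∞ arcLength := by
  have hp : ∀ p : ℝ≥0∞, MemLp (fun t => ∑ k ∈ s, fourier k t • fourierCoeff f k) p arcLength :=
    fun p => memLp_finsetSum s fun k _ => memLp_fourier_smul (memLp_const_circle p _) k
  have hz : (fun t => f t - ∑ k ∈ s, fourier k t • fourierCoeff f k) =ᵐ[arcLength] 0 := by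
    refine ae_eq_zero_of_fourierCoeff_eq_zero (hf.sub (hp 2)) fun n => ?_
    rw [fourierCoeff_fun_sub hf.integrable_circle (hp 2).integrable_circle]
    have hsum := congrFun (fourierCoeff.sum s (fun k t => fourier k t • fourierCoeff f k)
      fun k _ => (memLp_fourier_smul (memLp_const_circle 2 _) k).integrable_circle) n
    have he : (∑ k ∈ s, fun t : TCircle => fourier k t • fourierCoeff f k) =
        fun t => ∑ k ∈ s, fourier k t • fourierCoeff f k := by
      funext t
      rw [Finset.sum_apply]
    rw [he, Finset.sum_apply] at hsum
    rw [hsum]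
    simp only [fourierCoeff_fourier_smul, fourierCoeff_fun_const, sub_eq_zero (a := n)]
    rw [Finset.sum_ite_eq]
    split_ifs with hn
    · rw [sub_self]
    · rw [h n hn, sub_self]
  refine (memLp_congr_ae ?_).2 (hp ∞)
  filter_upwards [hz] with t ht
  exact sub_eq_zero.1 ht

/-- The projections of analytic monomials onto the model space are bounded. -/
lemma exists_boundedModel_monomial (hΘ : IsInner Θ) (n : ℤ) (hn : 0 ≤ n) (x : E) :
    ∃ h : TCircle → E, MemLp h 2 arcLength ∧ (∀ k < 0, fourierCoeff h k = 0) ∧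
      IsBoundedModel Θ fun t => fourier n t • x - Θ t (h t) := by
  have hz : MemLp (fun t => fourier n t • x) 2 arcLength :=
    memLp_fourier_smul (memLp_const_circle 2 x) n
  have hsz : MemLp (fun t => star (Θ t) (fourier n t • x)) 2 arcLength :=
    memLp_bounded_apply (memLp_star hΘ.memLp_top) hz
  obtain ⟨h, hh, hhc, -⟩ := exists_analytic_part hsz
  have hz' : ∀ k < 0, fourierCoeff (fun t => fourier n t • x) k = 0 := fun k hk => by
    rw [fourierCoeff_fourier_smul, fourierCoeff_fun_const, if_neg (by omega)]
  -- The k-th coefficient of Θ* z^n x is Θ̂(n - k)* x, which is zero for k > n. Hence the analytic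
  -- part h is a polynomial of degree at most n, and Θh is bounded.
  have hb : MemLp h ∞ arcLength := by
    refine memLp_top_of_fourierCoeff_support (Lp.memLp h) (Finset.Icc 0 n) fun k hk => ?_
    rcases lt_or_ge k 0 with hk0 | hk0
    · exact hh k hk0
    · have hnk : n < k := by
        by_contra hc
        exact hk (Finset.mem_Icc.2 ⟨hk0, not_lt.1 hc⟩)
      rw [hhc k hk0]
      simp only [map_smul]
      rw [fourierCoeff_fourier_smul, fourierCoeff_star_apply_const (Lp.memLp Θ),
        hΘ.1 _ (by omega), star_zero, zero_apply]
  have hm := sub_apply_mem_model hΘ hz hz' (Lp.memLp h) hh hhc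
  exact ⟨h, Lp.memLp h, hh, (memLp_fourier_smul (memLp_const_circle ∞ x) n).sub
    (memLp_bounded_apply hΘ.memLp_top hb), hm.1, hm.2⟩

/-- Moving Θ to the other side pairs the analytic h with the strictly antianalytic Θ*k. -/
lemma integral_inner_apply_eq_zero (hΘ : IsInner Θ) {h k : TCircle → E}
    (hh : MemLp h 2 arcLength) (hh' : ∀ n < 0, fourierCoeff h n = 0) (hk : MemLp k 2 arcLength)
    (hk' : ∀ n, 0 ≤ n → fourierCoeff (fun t => star (Θ t) (k t)) n = 0) :
    ∫ t, inner ℂ (Θ t (h t)) (k t) ∂arcLength = 0 := by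
  rw [← integral_inner_eq_zero_of_fourierCoeff hh
    (memLp_bounded_apply (memLp_star hΘ.memLp_top) hk) hh' hk']
  congr 1
  funext t
  rw [ContinuousLinearMap.star_eq_adjoint, ContinuousLinearMap.adjoint_inner_right]

/-- Bounded functions are dense in the model space: a function orthogonal to all bounded functions
in the model space is orthogonal to the model space. -/
lemma toLp_mem_orthogonal_modelSpace (hΘ : IsInner Θ) {v : TCircle → E}
    (hv : MemLp v 2 arcLength)
    (h : ∀ g, IsBoundedModel Θ g → ∫ t, inner ℂ (g t) (v t) ∂arcLength = 0) :
    hv.toLp v ∈ (modelSpace Θ)ᗮ := by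
  set k := (modelSpace Θ).starProjection (hv.toLp v) with hkdef
  have hk : k ∈ modelSpace Θ := Submodule.starProjection_apply_mem _ _
  have hko : hv.toLp v - k ∈ (modelSpace Θ)ᗮ := Submodule.sub_starProjection_mem_orthogonal _
  obtain ⟨hk1, hk2⟩ := (mem_modelSpace_iff hΘ).1 hk
  have hz : (k : TCircle → E) =ᵐ[arcLength] 0 := by
    refine ae_eq_zero_of_fourierCoeff_eq_zero (Lp.memLp k) fun n => ?_
    rcases lt_or_ge n 0 with hn | hn
    · exact hk1 n hn
    have hx : ∀ x : E, inner ℂ x (fourierCoeff k n) = 0 := by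
      intro x
      obtain ⟨p, hp, hp', hg⟩ := exists_boundedModel_monomial hΘ n hn x
      have hgm := (toLp_mem_modelSpace_iff hΘ hg.memLp_two).2 ⟨hg.analytic, hg.antianalytic⟩
      -- Both v and v - k are orthogonal to the bounded test function z^n x - Θp, hence so is k. As
      -- k is orthogonal to Θp, only ⟨x, k̂(n)⟩ remains.
      have h1 := hko _ hgm
      rw [inner_sub_right, inner_toLp_L2, h _ hg, zero_sub, neg_eq_zero,
        ← Lp.toLp_coeFn k (Lp.memLp k), inner_toLp_L2] at h1
      have hz : MemLp (fun t => fourier n t • x) 2 arcLength :=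
        memLp_fourier_smul (memLp_const_circle 2 x) n
      simp only [inner_sub_left] at h1
      rw [integral_sub (integrable_inner_L2 hz (Lp.memLp k))
        (integrable_inner_L2 (memLp_bounded_apply hΘ.memLp_top hp) (Lp.memLp k)),
        integral_inner_apply_eq_zero hΘ hp hp' (Lp.memLp k) hk2, sub_zero,
        integral_inner_fourier_smul x (L2.integrable k)] at h1
      exact h1
    exact inner_self_eq_zero.1 (hx _)
  rw [Lp.eq_zero_iff_ae_eq_zero.2 hz, sub_zero] at hko
  exact hko

/-- A function orthogonal to the model space is the sum of an element of `ΘH²` and a strictly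
antianalytic function. -/
lemma exists_theta_part (hΘ : IsInner Θ) {v : TCircle → E} (hv : MemLp v 2 arcLength)
    (hvo : hv.toLp v ∈ (modelSpace Θ)ᗮ) :
    ∃ h ∈ hardySpace E, ∀ n, 0 ≤ n → fourierCoeff (fun t => v t - Θ t (h t)) n = 0 := by
  obtain ⟨u, hu, huc, huo⟩ := exists_analytic_part hv
  obtain ⟨h, hh, hhc, -⟩ := exists_analytic_part
    (memLp_bounded_apply (memLp_star hΘ.memLp_top) (Lp.memLp u))
  have hΘh : MemLp (fun t => Θ t (h t)) 2 arcLength :=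
    memLp_bounded_apply hΘ.memLp_top (Lp.memLp h)
  have hm := sub_apply_mem_model hΘ (Lp.memLp u) hu (Lp.memLp h) hh hhc
  have hkL : MemLp (fun t => u t - Θ t (h t)) 2 arcLength := (Lp.memLp u).sub hΘh
  have hk : hkL.toLp _ ∈ modelSpace Θ := (toLp_mem_modelSpace_iff hΘ hkL).2 hm
  -- The candidate u - Θh lies in K. It is orthogonal to u, since v is orthogonal to K and v - u to
  -- H², and it is orthogonal to Θh. It is therefore orthogonal to itself.
  have hu0 : inner ℂ (hkL.toLp _) u = 0 := by
    have h1 := hvo _ hk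
    have h2 := huo _ hk.1
    rw [inner_sub_right, h1, zero_sub, neg_eq_zero] at h2
    exact h2
  have hΘ0 : inner ℂ (hkL.toLp _) (hΘh.toLp _) = 0 :=
    inner_eq_zero_symm.1 (hk.2 _ (toLp_mem_thetaHardy (Lp.memLp h) hh hΘh))
  have he : hkL.toLp _ = u - hΘh.toLp _ :=
    (MemLp.toLp_sub (Lp.memLp u) hΘh).trans (by rw [Lp.toLp_coeFn])
  have hz : hkL.toLp _ = 0 := by
    refine (inner_self_eq_zero (𝕜 := ℂ)).1 ((congrArg (inner ℂ (hkL.toLp _)) he).trans ?_)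
    rw [inner_sub_right, hu0, hΘ0, sub_zero]
  have hz' : fourierCoeff (fun t => u t - Θ t (h t)) = fourierCoeff (0 : TCircle → E) :=
    fourierCoeff_congr_ae (hkL.coeFn_toLp.symm.trans (Lp.eq_zero_iff_ae_eq_zero.1 hz))
  refine ⟨h, hh, fun n hn => ?_⟩
  have h1 := congrFun hz' n
  rw [fourierCoeff_fun_sub (L2.integrable u) hΘh.integrable_circle, huc n hn] at h1
  rw [fourierCoeff_fun_sub hv.integrable_circle hΘh.integrable_circle, h1]
  simp [fourierCoeff]

end Model

/-! ### Symbols with vanishing form: displacement and factorization -/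

section Annihilation

variable {E : Type*} [NormedAddCommGroup E] [InnerProductSpace ℂ E] [CompleteSpace E]

lemma memLp_mul_of_top {p : ℝ≥0∞} {Φ Ψ : TCircle → E →L[ℂ] E} (hΦ : MemLp Φ ∞ arcLength)
    (hΨ : MemLp Ψ p arcLength) : MemLp (fun t => Φ t * Ψ t) p arcLength :=
  (ContinuousLinearMap.mul ℂ (E →L[ℂ] E)).memLp_of_bilin p hΦ hΨ

/-- The sesquilinear form of the symbol `Ψ` vanishes on the bounded functions of the model
space. -/
def Annihilates (Θ : L2 (E →L[ℂ] E)) (Ψ : TCircle → E →L[ℂ] E) : Prop :=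
  ∀ f g, IsBoundedModel Θ f → IsBoundedModel Θ g →
    ∫ t, inner ℂ (g t) (Ψ t (f t)) ∂arcLength = 0

variable {Θ : L2 (E →L[ℂ] E)} {Ψ Ψ' : TCircle → E →L[ℂ] E}

lemma Annihilates.star (h : Annihilates Θ Ψ) : Annihilates Θ fun t => star (Ψ t) := by
  intro f g hf hg
  rw [← map_zero (starRingEnd ℂ), ← h g f hg hf, ← integral_conj]
  congr 1
  funext t
  change inner ℂ (g t) (Star.star (Ψ t) (f t)) = _
  rw [inner_conj_symm, ContinuousLinearMap.star_eq_adjoint,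
    ContinuousLinearMap.adjoint_inner_right]

lemma Annihilates.congr (h : Annihilates Θ Ψ) (he : Ψ =ᵐ[arcLength] Ψ') : Annihilates Θ Ψ' := by
  intro f g hf hg
  rw [← h f g hf hg]
  refine integral_congr_ae ?_
  filter_upwards [he] with t ht
  rw [ht]

lemma Annihilates.add (hΨ : MemLp Ψ 2 arcLength) (hΨ' : MemLp Ψ' 2 arcLength)
    (h : Annihilates Θ Ψ) (h' : Annihilates Θ Ψ') : Annihilates Θ fun t => Ψ t + Ψ' t := by
  intro f g hf hg
  simp only [_root_.add_apply, inner_add_right]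
  rw [integral_add (integrable_inner_L2 hg.memLp.two_of_top (memLp_apply hΨ hf.memLp))
    (integrable_inner_L2 hg.memLp.two_of_top (memLp_apply hΨ' hf.memLp)), h f g hf hg,
    h' f g hf hg, add_zero]

lemma Annihilates.neg (h : Annihilates Θ Ψ) : Annihilates Θ fun t => -Ψ t := by
  intro f g hf hg
  simp only [_root_.neg_apply, inner_neg_right]
  rw [integral_neg, h f g hf hg, neg_zero]

variable [FiniteDimensional ℂ E]

/-- For bounded analytic f the product Φf is in H², so ΘΦf is in ΘH², orthogonal to the model space.
-/
lemma annihilates_inner_mul (hΘ : IsInner Θ) {Φ : TCircle → E →L[ℂ] E} (hΦ : MemLp Φ 2 arcLength)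
    (hΦ' : ∀ n < 0, fourierCoeff Φ n = 0) : Annihilates Θ fun t => Θ t * Φ t := by
  intro f g hf hg
  rw [← map_zero (starRingEnd ℂ), ← integral_inner_apply_eq_zero hΘ (memLp_apply hΦ hf.memLp)
    (fun n hn => fourierCoeff_apply_eq_zero hΦ hf.memLp_two hΦ' hf.analytic hn) hg.memLp_two
    hg.antianalytic, ← integral_conj]
  congr 1
  funext t
  rw [inner_conj_symm]
  rfl

/-- The truncated Toeplitz operator of a symbol vanishes if and only if its sesquilinear form
vanishes on the bounded functions of the model space. -/
lemma isTruncatedToeplitz_zero_iff_annihilates (hΘ : IsInner Θ) (Ψ : L2 (E →L[ℂ] E)) :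
    IsTruncatedToeplitz Θ Ψ 0 ↔ Annihilates Θ Ψ := by
  constructor
  · intro h f g hf hg
    have hfK := (toLp_mem_modelSpace_iff hΘ hf.memLp_two).2 ⟨hf.analytic, hf.antianalytic⟩
    have hgK := (toLp_mem_modelSpace_iff hΘ hg.memLp_two).2 ⟨hg.analytic, hg.antianalytic⟩
    have hfb : MemLp (hf.memLp_two.toLp f) ∞ arcLength :=
      (memLp_congr_ae hf.memLp_two.coeFn_toLp).2 hf.memLp
    have h0 : compression Θ Ψ ⟨⟨_, hfK⟩, hfb⟩ = 0 := (h ⟨⟨_, hfK⟩, hfb⟩).symm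
    have h1 : (memLp_symbol_apply Ψ hfb).toLp _ ∈ (modelSpace Θ)ᗮ :=
      Submodule.orthogonalProjectionOnto_eq_zero_iff.1 h0
    rw [← h1 _ hgK, inner_toLp_L2]
    refine integral_congr_ae ?_
    filter_upwards [hf.memLp_two.coeFn_toLp] with t ht
    rw [ht]
  · intro h f
    obtain ⟨h1, h2⟩ := (mem_modelSpace_iff hΘ).1 f.1.2
    have hf : IsBoundedModel Θ ((f : modelSpace Θ) : L2 E) := ⟨f.2, h1, h2⟩
    -- The form tests Ψf against bounded g only; density extends the orthogonality to all of K.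
    exact (Submodule.orthogonalProjectionOnto_eq_zero_iff.2
      (toLp_mem_orthogonal_modelSpace hΘ (memLp_symbol_apply Ψ f.2)
        fun g hg => h _ g hf hg)).symm

/-- The backward shift preserves bounded functions in the model space. -/
lemma IsBoundedModel.backwardShift (hΘ : IsInner Θ) {f : TCircle → E} (hf : IsBoundedModel Θ f) :
    IsBoundedModel Θ fun t => fourier (-1) t • (f t - fourierCoeff f 0) := by
  have hc : ∀ p, MemLp (fun _ : TCircle => fourierCoeff f 0) p arcLength :=
    fun p => memLp_const_circle p _
  refine ⟨memLp_fourier_smul (hf.memLp.sub (hc ∞)) _, fun n hn => ?_, fun n hn => ?_⟩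
  · rw [fourierCoeff_fourier_smul, fourierCoeff_fun_sub hf.memLp_two.integrable_circle
      (hc 2).integrable_circle, fourierCoeff_fun_const]
    by_cases h0 : n - -1 = 0
    · rw [if_pos h0, h0, sub_self]
    · rw [if_neg h0, sub_zero, hf.analytic _ (by omega)]
  -- The factor z̄ moves the coefficient of index n + 1 to index n. As n + 1 > 0, the coefficient
  -- Θ̂(-(n + 1))* of Θ* is zero, so subtracting the constant f(0) does no harm.
  · simp only [map_smul]
    rw [fourierCoeff_fourier_smul]
    simp only [map_sub]
    rw [fourierCoeff_fun_sub
      (memLp_bounded_apply (memLp_star hΘ.memLp_top) hf.memLp_two).integrable_circle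
      (memLp_bounded_apply (memLp_star hΘ.memLp_top) (hc 2)).integrable_circle,
      fourierCoeff_star_apply_const (Lp.memLp Θ), hΘ.1 _ (by omega),
      hf.antianalytic _ (by omega), star_zero, zero_apply, sub_zero]

/-- The displacement identity obtained by comparing the form on a pair and on its backward
shift. -/
lemma Annihilates.displacement (hΘ : IsInner Θ) (hΨ : MemLp Ψ 2 arcLength)
    (h : Annihilates Θ Ψ) {f g : TCircle → E} (hf : IsBoundedModel Θ f)
    (hg : IsBoundedModel Θ g) :
    ∫ t, inner ℂ (g t) (Ψ t (fourierCoeff f 0)) ∂arcLength +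
      inner ℂ (fourierCoeff g 0) (fourierCoeff (fun t => Ψ t (f t - fourierCoeff f 0)) 0) = 0 := by
  have hfc : MemLp (fun t => f t - fourierCoeff f 0) ∞ arcLength :=
    hf.memLp.sub (memLp_const_circle ∞ _)
  have h1 := h _ _ (hf.backwardShift hΘ) (hg.backwardShift hΘ)
  have h2 := h f g hf hg
  have i1 := integrable_inner_L2 hg.memLp_two (memLp_apply hΨ hf.memLp)
  have i2 := integrable_inner_L2 hg.memLp_two
    (memLp_apply hΨ (memLp_const_circle ∞ (fourierCoeff f 0)))
  have i3 := integrable_inner_L2 (memLp_const_circle 2 (fourierCoeff g 0)) (memLp_apply hΨ hfc)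
  have h3 : ∫ t, inner ℂ (fourierCoeff g 0) (Ψ t (f t - fourierCoeff f 0)) ∂arcLength =
      inner ℂ (fourierCoeff g 0) (fourierCoeff (fun t => Ψ t (f t - fourierCoeff f 0)) 0) := by
    rw [← integral_inner_fourier_smul _ (memLp_apply hΨ hfc).integrable_circle]
    simp
  have h4 : ∀ t, inner ℂ (fourier (-1) t • (g t - fourierCoeff g 0))
      (Ψ t (fourier (-1) t • (f t - fourierCoeff f 0))) =
      inner ℂ (g t) (Ψ t (f t)) - inner ℂ (g t) (Ψ t (fourierCoeff f 0)) -
        inner ℂ (fourierCoeff g 0) (Ψ t (f t - fourierCoeff f 0)) := by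
    intro t
    have hz : fourier (-1) t * (starRingEnd ℂ) (fourier (-1) t) = 1 := by
      rw [Complex.mul_conj', norm_fourier_apply]
      simp
    rw [map_smul, inner_smul_left, inner_smul_right, ← mul_assoc, mul_comm (starRingEnd ℂ _), hz,
      one_mul, inner_sub_left, ← inner_sub_right, ← map_sub]
  simp only [h4] at h1
  have i12 : Integrable (fun t => inner ℂ (g t) (Ψ t (f t)) -
      inner ℂ (g t) (Ψ t (fourierCoeff f 0))) arcLength := i1.sub i2
  rw [integral_sub i12 i3, integral_sub i1 i2, h2, h3] at h1
  linear_combination -h1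

/-- Every vector is the value at the origin of a bounded function in the model space. -/
lemma exists_boundedModel_fourierCoeff_zero (hΘ : IsPureInner Θ) (x : E) :
    ∃ f, IsBoundedModel Θ f ∧ fourierCoeff f 0 = x := by
  -- The analytic part of Θ*y is the constant T*y, so y - ΘT*y is the projection of the constant y
  -- onto K. Its value at the origin is (1 - TT*)y, and ‖T‖ < 1 makes 1 - TT* invertible.
  set T := fourierCoeff Θ 0
  have hlt : ‖T * star T‖ < 1 := by
    rw [CStarRing.norm_self_mul_star]
    exact mul_lt_one_of_nonneg_of_lt_one_left (norm_nonneg _) hΘ.2 hΘ.2.le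
  obtain ⟨u, hu⟩ := isUnit_one_sub_of_norm_lt_one hlt
  set y := (↑u⁻¹ : E →L[ℂ] E) x with hy
  have hyx : y - T (star T y) = x := by
    have h : ((u : E →L[ℂ] E) * (↑u⁻¹ : E →L[ℂ] E)) x = x := by rw [Units.mul_inv]; rfl
    rw [hu] at h
    exact h
  have hc : ∀ (p : ℝ≥0∞) (z : E), MemLp (fun _ : TCircle => z) p arcLength :=
    fun p z => memLp_const_circle p z
  have hneg : ∀ z : E, ∀ n < 0, fourierCoeff (fun _ : TCircle => z) n = 0 := fun z n hn => by
    rw [fourierCoeff_fun_const, if_neg hn.ne]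
  have hm := sub_apply_mem_model hΘ.1 (hc 2 y) (hneg y) (hc 2 (star T y)) (hneg _) (by
    intro n hn
    rw [fourierCoeff_star_apply_const (Lp.memLp Θ), fourierCoeff_fun_const]
    rcases hn.eq_or_lt with rfl | hn
    · rw [if_pos rfl, neg_zero]
    · rw [if_neg hn.ne', hΘ.1.1 _ (by omega), star_zero, zero_apply])
  refine ⟨fun t => y - Θ t (star T y), ⟨(hc ∞ y).sub
    (memLp_bounded_apply hΘ.1.memLp_top (hc ∞ _)), hm.1, hm.2⟩, ?_⟩
  rw [fourierCoeff_fun_sub (hc 2 y).integrable_circle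
    (memLp_bounded_apply hΘ.1.memLp_top (hc 2 _)).integrable_circle, fourierCoeff_fun_const,
    if_pos rfl, fourierCoeff_apply_const (L2.integrable Θ)]
  exact hyx

/-- Choosing f with f(0) = x, displacement says that Ψx + c is orthogonal to K. The constant c
affects only index 0, which is why only positive indices are controlled. -/
lemma Annihilates.exists_analytic_column (hΘ : IsPureInner Θ) (hΨ : MemLp Ψ 2 arcLength)
    (h : Annihilates Θ Ψ) (x : E) :
    ∃ k ∈ hardySpace E, ∀ n, 0 < n → fourierCoeff (fun t => Ψ t x - Θ t (k t)) n = 0 := by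
  obtain ⟨f, hf, rfl⟩ := exists_boundedModel_fourierCoeff_zero hΘ x
  set c := fourierCoeff (fun t => Ψ t (f t - fourierCoeff f 0)) 0
  have hΨx : MemLp (fun t => Ψ t (fourierCoeff f 0)) 2 arcLength :=
    memLp_apply hΨ (memLp_const_circle ∞ _)
  have hc : MemLp (fun _ : TCircle => c) 2 arcLength := memLp_const_circle 2 c
  have hv : MemLp (fun t => Ψ t (fourierCoeff f 0) + c) 2 arcLength := hΨx.add hc
  have ho := toLp_mem_orthogonal_modelSpace hΘ.1 hv (by
    intro g hg
    simp only [inner_add_right]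
    rw [integral_add (integrable_inner_L2 hg.memLp_two hΨx) (integrable_inner_L2 hg.memLp_two hc),
      ← h.displacement hΘ.1 hΨ hf hg]
    congr 1
    rw [← inner_conj_symm, ← integral_inner_fourier_smul _ hg.memLp_two.integrable_circle,
      ← integral_conj]
    congr 1
    funext t
    rw [inner_conj_symm, fourier_zero, one_smul])
  obtain ⟨k, hk, hkc⟩ := exists_theta_part hΘ.1 hv ho
  refine ⟨k, hk, fun n hn => ?_⟩
  have hΘk : MemLp (fun t => Θ t (k t)) 2 arcLength :=
    memLp_bounded_apply hΘ.1.memLp_top (Lp.memLp k)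
  have h1 := hkc n hn.le
  rw [fourierCoeff_fun_sub hv.integrable_circle hΘk.integrable_circle,
    fourierCoeff_fun_add hΨx.integrable_circle hc.integrable_circle, fourierCoeff_fun_const,
    if_neg hn.ne', add_zero] at h1
  rw [fourierCoeff_fun_sub hΨx.integrable_circle hΘk.integrable_circle, h1]

/-- The columns are chosen on an orthonormal basis only, so they need not depend linearly on the
vector. -/
lemma Annihilates.exists_analytic_factor (hΘ : IsPureInner Θ) (hΨ : MemLp Ψ 2 arcLength)
    (h : Annihilates Θ Ψ) :
    ∃ Φ ∈ hardySpace (E →L[ℂ] E),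
      ∀ n, 0 < n → fourierCoeff (fun t => Ψ t - Θ t * Φ t) n = 0 := by
  let b := stdOrthonormalBasis ℂ E
  choose k hk hkc using fun i => h.exists_analytic_column hΘ hΨ (b i)
  -- `L i y` is the rank-one operator z ↦ ⟨b i, z⟩ y, so the sum of the `L i (k i t)` sends `b i` to
  -- `k i t`.
  let L : ∀ i, E →L[ℂ] (E →L[ℂ] E) := fun i =>
    ContinuousLinearMap.smulRightL ℂ E E (innerSL ℂ (b i))
  have hL : ∀ i y z, L i y z = inner ℂ (b i) z • y := fun i y z => rfl
  have hi : ∀ i, MemLp (fun t => L i (k i t)) 2 arcLength :=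
    fun i => (L i).comp_memLp' (Lp.memLp (k i))
  have hm : MemLp (fun t => ∑ i, L i (k i t)) 2 arcLength := memLp_finsetSum _ fun i _ => hi i
  have hb : ∀ t i, (∑ j, L j (k j t)) (b i) = k i t := by
    intro t i
    rw [sum_apply]
    simp only [hL, b.inner_eq_ite, ite_smul, one_smul, zero_smul]
    simp
  have han : ∀ n < 0, fourierCoeff (fun t => ∑ i, L i (k i t)) n = 0 := by
    intro n hn
    refine ContinuousLinearMap.coe_injective (b.toBasis.ext fun i => ?_)
    have h1 := fourierCoeff_apply_const hm.integrable_circle (b i) n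
    simp only [hb] at h1
    rw [hk i n hn] at h1
    simpa using h1.symm
  refine ⟨hm.toLp _, toLp_mem_hardySpace hm han, fun n hn => ?_⟩
  have hΘm := memLp_mul_of_top hΘ.1.memLp_top (Lp.memLp (hm.toLp _))
  refine ContinuousLinearMap.coe_injective (b.toBasis.ext fun i => ?_)
  have hsub : MemLp (fun t => Ψ t - Θ t * hm.toLp _ t) 2 arcLength := hΨ.sub hΘm
  have h1 := fourierCoeff_apply_const hsub.integrable_circle (b i) n
  have h2 : (fun t => (Ψ t - Θ t * hm.toLp _ t) (b i)) =ᵐ[arcLength]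
      fun t => Ψ t (b i) - Θ t (k i t) := by
    filter_upwards [hm.coeFn_toLp] with t ht
    change Ψ t (b i) - Θ t (hm.toLp _ t (b i)) = _
    rw [ht, hb]
  rw [fourierCoeff_congr_ae h2, hkc i n hn] at h1
  simpa using h1.symm

lemma fourierCoeff_inner_mul_eq_zero (hΘ : IsInner Θ) {Φ : TCircle → E →L[ℂ] E}
    (hΦ : MemLp Φ 2 arcLength) (hΦ' : ∀ n < 0, fourierCoeff Φ n = 0) {n : ℤ} (hn : n < 0) :
    fourierCoeff (fun t => Θ t * Φ t) n = 0 := by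
  ext x
  rw [← fourierCoeff_apply_const (memLp_mul_of_top hΘ.memLp_top hΦ).integrable_circle]
  exact hΘ.fourierCoeff_apply_eq_zero (memLp_apply hΦ (memLp_const_circle ∞ x)) (fun k hk => by
    rw [fourierCoeff_apply_const hΦ.integrable_circle, hΦ' k hk, zero_apply]) hn

/-- A symbol with vanishing form all of whose nonzero Fourier coefficients vanish is zero. -/
lemma Annihilates.ae_eq_zero_of_fourierCoeff (hΘ : IsPureInner Θ) (hΨ : MemLp Ψ 2 arcLength)
    (h : Annihilates Θ Ψ) (hc : ∀ n, n ≠ 0 → fourierCoeff Ψ n = 0) : Ψ =ᵐ[arcLength] 0 := by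
  set B := fourierCoeff Ψ 0
  let b := stdOrthonormalBasis ℂ E
  have hx : ∀ i, (fun t => Ψ t (b i) - B (b i)) =ᵐ[arcLength] 0 := by
    intro i
    have hΨb : MemLp (fun t => Ψ t (b i)) 2 arcLength := memLp_apply hΨ (memLp_const_circle ∞ _)
    refine ae_eq_zero_of_fourierCoeff_eq_zero (hΨb.sub (memLp_const_circle 2 _)) fun n => ?_
    rw [fourierCoeff_fun_sub hΨb.integrable_circle (memLp_const_circle 2 _).integrable_circle,
      fourierCoeff_apply_const hΨ.integrable_circle, fourierCoeff_fun_const]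
    by_cases hn : n = 0
    · rw [if_pos hn, hn, sub_self]
    · rw [if_neg hn, hc n hn, zero_apply, sub_zero]
  have hB : Ψ =ᵐ[arcLength] fun _ => B := by
    filter_upwards [ae_all_iff.2 hx] with t ht
    refine ContinuousLinearMap.coe_injective (b.toBasis.ext fun i => ?_)
    simpa [sub_eq_zero] using ht i
  have hB0 : B = 0 := by
    ext x
    obtain ⟨f, hf, rfl⟩ := exists_boundedModel_fourierCoeff_zero hΘ x
    obtain ⟨g, hg, hgx⟩ := exists_boundedModel_fourierCoeff_zero hΘ (B (fourierCoeff f 0))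
    -- For a constant symbol the second displacement term is zero, since f - f(0) has mean zero.
    -- What remains is ∫⟨g, Bf(0)⟩ = 0, and g was chosen with g(0) = Bf(0).
    have h1 := (h.congr hB).displacement hΘ.1 (memLp_const_circle 2 B) hf hg
    have hfi := hf.memLp_two.integrable_circle
    have hci := (memLp_const_circle 2 (fourierCoeff f 0)).integrable_circle
    have hfci : Integrable (fun t => f t - fourierCoeff f 0) arcLength := hfi.sub hci
    rw [fourierCoeff_clm_apply B hfci, fourierCoeff_fun_sub hfi hci,
      fourierCoeff_fun_const, if_pos rfl, sub_self, map_zero, inner_zero_right, add_zero] at h1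
    have h2 := integral_inner_fourier_smul (B (fourierCoeff f 0)) hg.memLp_two.integrable_circle 0
    simp only [fourier_zero, one_smul] at h2
    rw [← map_eq_zero (starRingEnd ℂ), ← integral_conj] at h1
    simp only [inner_conj_symm] at h1
    rw [h1, hgx] at h2
    exact inner_self_eq_zero.1 h2.symm
  rw [hB0] at hB
  exact hB

end Annihilation

theorem mainTheorem3 {E : Type*} [NormedAddCommGroup E] [InnerProductSpace ℂ E] [CompleteSpace E]
    [FiniteDimensional ℂ E] (Θ : L2 (E →L[ℂ] E)) (hΘ : IsPureInner Θ) (Ψ : L2 (E →L[ℂ] E)) :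
    IsTruncatedToeplitz Θ Ψ 0 ↔
      ∃ Φ₁ ∈ hardySpace (E →L[ℂ] E), ∃ Φ₂ ∈ hardySpace (E →L[ℂ] E),
        Ψ =ᵐ[arcLength] fun t => Θ t * Φ₁ t + star (Φ₂ t) * star (Θ t) := by
  have hm : ∀ Φ : L2 (E →L[ℂ] E), MemLp (fun t => Θ t * Φ t) 2 arcLength :=
    fun Φ => memLp_mul_of_top hΘ.1.memLp_top (Lp.memLp Φ)
  have hstar : ∀ Φ : L2 (E →L[ℂ] E), ∀ t, star (Φ t) * star (Θ t) = star (Θ t * Φ t) :=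
    fun Φ t => (star_mul _ _).symm
  simp only [hstar]
  rw [isTruncatedToeplitz_zero_iff_annihilates hΘ.1]
  have hann : ∀ Φ₁ ∈ hardySpace (E →L[ℂ] E), ∀ Φ₂ ∈ hardySpace (E →L[ℂ] E),
      Annihilates Θ fun t => Θ t * Φ₁ t + star (Θ t * Φ₂ t) := fun Φ₁ h₁ Φ₂ h₂ =>
    Annihilates.add (hm Φ₁) (memLp_star (hm Φ₂)) (annihilates_inner_mul hΘ.1 (Lp.memLp Φ₁) h₁)
      (annihilates_inner_mul hΘ.1 (Lp.memLp Φ₂) h₂).star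
  constructor
  · intro h
    have hΨ : MemLp Ψ 2 arcLength := Lp.memLp Ψ
    obtain ⟨Φ₁, h₁, hc₁⟩ := h.exists_analytic_factor hΘ hΨ
    obtain ⟨Φ₂, h₂, hc₂⟩ := h.star.exists_analytic_factor hΘ (memLp_star hΨ)
    refine ⟨Φ₁, h₁, Φ₂, h₂, ?_⟩
    have hs := memLp_star (hm Φ₂)
    have hneg : MemLp (fun t => -(Θ t * Φ₁ t + star (Θ t * Φ₂ t))) 2 arcLength :=
      ((hm Φ₁).add hs).neg
    have hsum : MemLp (fun t => Ψ t + -(Θ t * Φ₁ t + star (Θ t * Φ₂ t))) 2 arcLength :=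
      hΨ.add hneg
    have h0 := (Annihilates.add hΨ hneg h (hann Φ₁ h₁ Φ₂ h₂).neg).ae_eq_zero_of_fourierCoeff hΘ
      hsum (by
      intro n hn
      have i₀ := hΨ.integrable_circle
      have i₁ := (hm Φ₁).integrable_circle
      have i₂ := hs.integrable_circle
      have i₁₂ : Integrable (fun t => Θ t * Φ₁ t + star (Θ t * Φ₂ t)) arcLength := i₁.add i₂
      have e : (fun t => Ψ t + -(Θ t * Φ₁ t + star (Θ t * Φ₂ t))) =
          fun t => Ψ t - (Θ t * Φ₁ t + star (Θ t * Φ₂ t)) := by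
        funext t
        rw [sub_eq_add_neg]
      rw [e, fourierCoeff_fun_sub i₀ i₁₂, fourierCoeff_fun_add i₁ i₂,
        fourierCoeff_star (hm Φ₂).integrable_circle]
      -- At negative indices ΘΦ₁ contributes nothing and (ΘΦ₂)* matches Ψ, by the factorization of
      -- Ψ* at -n. At positive indices the roles are exchanged.
      rcases lt_or_gt_of_ne hn with hn | hn
      · have h3 := hc₂ (-n) (by omega)
        rw [fourierCoeff_fun_sub (memLp_star hΨ).integrable_circle (hm Φ₂).integrable_circle,
          fourierCoeff_star i₀, neg_neg, sub_eq_zero] at h3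
        rw [fourierCoeff_inner_mul_eq_zero hΘ.1 (Lp.memLp Φ₁) h₁ hn, ← h3, star_star, zero_add,
          sub_self]
      · have h3 := hc₁ n hn
        rw [fourierCoeff_fun_sub i₀ i₁] at h3
        rw [fourierCoeff_inner_mul_eq_zero hΘ.1 (Lp.memLp Φ₂) h₂ (by omega : -n < 0), star_zero,
          add_zero, h3])
    filter_upwards [h0] with t ht
    exact add_neg_eq_zero.1 ht
  · rintro ⟨Φ₁, h₁, Φ₂, h₂, he⟩
    exact (hann Φ₁ h₁ Φ₂ h₂).congr he.symm
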